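/- All manifolds are smooth and paracompact. Let $\kappa\colon F\to M$ be a fibred manifold (for instance a fibre bundle), $\dim M=m>1$, $\dim F=m+n$, let $\eta$ be a volume form on $M$, let $\Omega$ be a closed $(m+1)$-form on $F$ with $i(Z_1)i(Z_2)i(Z_3)\Omega=0$ for all $\kappa$-vertical $Z_1,Z_2,Z_3$, and let $\nabla$ be an Ehresmann connection in $\kappa$, with horizontal bundle $\mathrm H(\nabla)$; write $\mathrm V(\kappa)=\ker \mathrm T\kappa$, and ${}^H,{}^V$ for the horizontal and vertical components. For $y\in F$ let $(\mathrm T_y\kappa_{\mathrm H(\nabla)})^{-1}\colon \mathrm T_{\kappa(y)}M\to \mathrm H_y(\nabla)$ be the horizontal lift, let $\mathcal Y(y)$ be the horizontal lift of the $m$-vector $\mathcal Z$ at $\kappa(y)$ with $\eta(\mathcal Z)=1$, and let $\gamma=i(\mathcal Y)\Omega$, where $i(w_1\wedge\dots\wedge w_m)\Omega=\Omega(w_1,\dots,w_m,\cdot)$. For a submanifold $C\subseteq F$, $y\in C$ and a linear map $h\colon \mathrm T_{\kappa(y)}M\to \mathrm T_yC$ put $$\flat_y(h)=\bigl(h^H,\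 i\bigl(i(h^V\circ \mathrm T_y\kappa)\mathcal Y\bigr)\Omega|_{\mathrm V_y(\kappa)}\bigr)\in W_y:=\mathrm{Lin}(\mathrm T_{\kappa(y)}M,\mathrm H_y(\nabla))\times \mathrm V_y^*(\kappa),$$ where $i(A)(w_1\wedge\dots\wedge w_m)=\sum_\alpha w_1\wedge\dots\wedge Aw_\alpha\wedge\dots\wedge w_m$. The orthogonal complement of $\mathrm T_yC$ is the annihilator $$(\mathrm T_y^\perp C)^\nabla_\Omega=(\operatorname{Im}\flat_y)^0\subseteq W_y^*=(\mathrm T_{\kappa(y)}M\otimes \mathrm V_y(\kappa)^0)\times \mathrm V_y(\kappa),$$ for the pairing $\langle (h^*,Z),(u,\psi)\rangle=h^*(u)+\psi(Z)$, $(x\otimes\beta)(u)=\beta(u(x))$. Let $\sigma$ be the section $\sigma(y)=\bigl((\mathrm T_y\kappa_{\mathrm H(\nabla)})^{-1},-\gamma(y)|_{\mathrm V_y(\kappa)}\bigr)$ of $W$. Put $C_0=F$ and, for $i\ge1$, let $C_i$ be the set of the $y\in C_{i-1}$ for which there is a linear map $h\colon \mathrm T_{\kappa(y)}M\to \mathrm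 T_yC_{i-1}$ with $\flat_y(h)=\sigma(y)$. Assume that every $C_i$ is a regular (embedded) submanifold of $F$. Theorem. Let $i\ge 1$. (1) $C_i$ is the set of the points $y\in C_{i-1}$ at which the field equations have a solution tangent to $C_{i-1}$, that is, for which there is a linear map $h\colon \mathrm T_{\kappa(y)}M\to \mathrm T_yC_{i-1}$ with $\mathrm T_y\kappa\circ h=\mathrm{Id}$ and $\Omega(h(X_1),\dots,h(X_m),Y)=0$ for all $X_1,\dots,X_m\in \mathrm T_{\kappa(y)}M$ and $Y\in \mathrm T_yF$. (2) $C_i=\{y\in C_{i-1} : \langle p,\sigma(y)\rangle=0\text{ for all }p\in(\mathrm T^\perp_yC_{i-1})^\nabla_\Omega\}$. (3) Suppose that $(\mathrm T^\perp C_{i-1})^\nabla_\Omega$ is a vector subbundle of rank $r$, that is, $\dim(\mathrm T_y^\perp C_{i-1})^\nabla_\Omega=r$ for every $y\in C_{i-1}$. Let $U\subseteq F$ be open and let $(h^*_1,Z_1),\dots,(h^*_r,Z_r)$ be smooth sections of $W^*$ over $U$ that span $(\mathrm T_y^\perp C_{i-1})^\nabla_\Omega$ at every $y\in C_{i-1}\cap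 U$. Then the functions $\xi_j=\langle(h_j^*,Z_j),\sigma\rangle$ (the $i$th-generation constraints) are smooth on $U$, and $C_i\cap U=\{y\in C_{i-1}\cap U : \xi_1(y)=\dots=\xi_r(y)=0\}$. -/

import Mathlib

open scoped Manifold ContDiff Topology

namespace PreMultisymplectic

/-! ### Linear theory

`σ : W → E` is a surjection, `nab : E → W` a linear section of it (so `W = range nab ⊕ ker σ`),
`η` a volume element on `E`, `Ω` an `(m+1)`-form on `W`. -/

section Linear

variable {m : ℕ} {E W : Type*} [AddCommGroup E] [Module ℝ E] [AddCommGroup W] [Module ℝ W]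

/-- The horizontal projection of `W`, with values in the horizontal subspace `H(∇) = Im ∇`. -/
def horProj (σ : W →ₗ[ℝ] E) (nab : E →ₗ[ℝ] W) : W →ₗ[ℝ] LinearMap.range nab :=
  nab.rangeRestrict ∘ₗ σ

/-- The vertical projection `w ↦ w - w^H` of `W`. -/
def vertProj (σ : W →ₗ[ℝ] E) (nab : E →ₗ[ℝ] W) : W →ₗ[ℝ] W :=
  LinearMap.id - (LinearMap.range nab).subtype ∘ₗ horProj σ nab

/-- The endomorphism `h^V ∘ σ` of `W` attached to a linear map `h : E → W`, where `h^V` is the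
vertical component of `h`. -/
def vertTilde (σ : W →ₗ[ℝ] E) (nab h : E →ₗ[ℝ] W) : W →ₗ[ℝ] W :=
  (vertProj σ nab ∘ₗ h) ∘ₗ σ

/-- The contraction `i(w₁ ∧ ⋯ ∧ wₘ)Ω`, i.e. the covector `v ↦ Ω(w₁, …, wₘ, v)`. -/
def contract (Ω : W [⋀^Fin (m + 1)]→ₗ[ℝ] ℝ) (w : Fin m → W) : W →ₗ[ℝ] ℝ :=
  Ω.toMultilinearMap.curryRight w

/-- Let `Z` be the `m`-vector on `E` with `η(Z) = 1`, that is `Z = η(e)⁻¹ e₁ ∧ ⋯ ∧ eₘ` for any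
basis `e` of `E`, and let `Y = Λᵐ∇(Z) = η(e)⁻¹ ∇e₁ ∧ ⋯ ∧ ∇eₘ`. This is the covector
`γ = i(Y)Ω`. It does not depend on `e`. -/
noncomputable def gammaForm (e : Module.Basis (Fin m) ℝ E) (η : E [⋀^Fin m]→ₗ[ℝ] ℝ)
    (Ω : W [⋀^Fin (m + 1)]→ₗ[ℝ] ℝ) (nab : E →ₗ[ℝ] W) : W →ₗ[ℝ] ℝ :=
  (η e)⁻¹ • contract Ω (fun α => nab (e α))

/-- With `Y` as above and `A` an endomorphism of `W`, this is the covector `i(i(A)Y)Ω`, where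
`i(A)` acts on `m`-vectors as a derivation:
`i(A)(w₁ ∧ ⋯ ∧ wₘ) = ∑ α, w₁ ∧ ⋯ ∧ A w_α ∧ ⋯ ∧ wₘ`. -/
noncomputable def derivedForm (e : Module.Basis (Fin m) ℝ E) (η : E [⋀^Fin m]→ₗ[ℝ] ℝ)
    (Ω : W [⋀^Fin (m + 1)]→ₗ[ℝ] ℝ) (nab : E →ₗ[ℝ] W) (A : W →ₗ[ℝ] W) : W →ₗ[ℝ] ℝ :=
  (η e)⁻¹ • ∑ α : Fin m,
    contract Ω (Function.update (fun β => nab (e β)) α (A (nab (e α))))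

/-- The space `Lin(E, H(∇)) × V(σ)^*`. -/
abbrev PairSpace (σ : W →ₗ[ℝ] E) (nab : E →ₗ[ℝ] W) : Type _ :=
  (E →ₗ[ℝ] LinearMap.range nab) × Module.Dual ℝ (LinearMap.ker σ)

/-- The map `♭ : Lin(E, C) → Lin(E, H(∇)) × V(σ)^*`,
`h ↦ (h^H, i(i(h^V ∘ σ)Y)Ω|_{V(σ)})`. -/
noncomputable def flat (e : Module.Basis (Fin m) ℝ E) (η : E [⋀^Fin m]→ₗ[ℝ] ℝ)
    (Ω : W [⋀^Fin (m + 1)]→ₗ[ℝ] ℝ) (σ : W →ₗ[ℝ] E) (nab : E →ₗ[ℝ] W) (C : Submodule ℝ W)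
    (h : E →ₗ[ℝ] C) : PairSpace σ nab :=
  (horProj σ nab ∘ₗ (C.subtype ∘ₗ h),
    (derivedForm e η Ω nab (vertTilde σ nab (C.subtype ∘ₗ h))).domRestrict (LinearMap.ker σ))

/-- The element `((σ|_{H(∇)})⁻¹, -γ|_{V(σ)})` of `Lin(E, H(∇)) × V(σ)^*`; its first component is
the horizontal lift `E → H(∇)`, i.e. `nab` itself. -/
noncomputable def target (e : Module.Basis (Fin m) ℝ E) (η : E [⋀^Fin m]→ₗ[ℝ] ℝ)
    (Ω : W [⋀^Fin (m + 1)]→ₗ[ℝ] ℝ) (σ : W →ₗ[ℝ] E) (nab : E →ₗ[ℝ] W) : PairSpace σ nab :=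
  (nab.rangeRestrict, (-gammaForm e η Ω nab).domRestrict (LinearMap.ker σ))

/-- The space `E ⊗ V(σ)⁰`, realised as the linear maps `W → E` that vanish on `V(σ)`: the tensor
`x ⊗ β` is the map `w ↦ β(w) x`. -/
def horDual (σ : W →ₗ[ℝ] E) : Submodule ℝ (W →ₗ[ℝ] E) where
  carrier := {A | ∀ v ∈ LinearMap.ker σ, A v = 0}
  add_mem' := by
    intro A B hA hB v hv
    simp [hA v hv, hB v hv]
  zero_mem' := by
    intro v _
    simp
  smul_mem' := by
    intro c A hA v hv
    simp [hA v hv]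

/-- The space `(E ⊗ V(σ)⁰) × V(σ)`, the dual of `Lin(E, H(∇)) × V(σ)^*`. -/
abbrev DualPairSpace (σ : W →ₗ[ℝ] E) : Type _ :=
  horDual σ × LinearMap.ker σ

/-- The duality pairing `⟨(h*, Z), (u, ψ)⟩ = h*(u) + ψ(Z)`, where `h*(u)` is the natural
contraction, `(x ⊗ β)(u) = β(u(x))`, i.e. the trace of `h* ∘ u`. -/
noncomputable def pairing (σ : W →ₗ[ℝ] E) (nab : E →ₗ[ℝ] W) :
    DualPairSpace σ →ₗ[ℝ] PairSpace σ nab →ₗ[ℝ] ℝ :=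
  LinearMap.mk₂ ℝ
    (fun p q => LinearMap.trace ℝ E ((p.1 : W →ₗ[ℝ] E) ∘ₗ (LinearMap.range nab).subtype ∘ₗ q.1)
      + q.2 p.2)
    (by intro p p' q; simp [LinearMap.add_comp]; ring)
    (by intro c p q; simp [LinearMap.smul_comp]; ring)
    (by intro p q q'; simp [LinearMap.comp_add]; ring)
    (by intro c p q; simp [LinearMap.comp_smul]; ring)

/-- The orthogonal complement of `C` with respect to `Ω` and `∇`: the annihilator `(Im ♭)⁰`. -/
noncomputable def orthComplement (e : Module.Basis (Fin m) ℝ E) (η : E [⋀^Fin m]→ₗ[ℝ] ℝ)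
    (Ω : W [⋀^Fin (m + 1)]→ₗ[ℝ] ℝ) (σ : W →ₗ[ℝ] E) (nab : E →ₗ[ℝ] W) (C : Submodule ℝ W) :
    Submodule ℝ (DualPairSpace σ) where
  carrier := {p | ∀ h : E →ₗ[ℝ] C, pairing σ nab p (flat e η Ω σ nab C h) = 0}
  add_mem' := by
    intro p q hp hq h
    rw [map_add, LinearMap.add_apply, hp h, hq h, add_zero]
  zero_mem' := by
    intro h
    rw [map_zero, LinearMap.zero_apply]
  smul_mem' := by
    intro c p hp h
    rw [map_smul, LinearMap.smul_apply, hp h, smul_zero]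

end Linear

/-! ### Manifolds, forms, submanifolds -/

section Manifold

/-- A (not necessarily smooth) field of exterior `k`-forms on a `d`-dimensional manifold. -/
abbrev FormField (d k : ℕ) (N : Type*) [TopologicalSpace N]
    [ChartedSpace (EuclideanSpace ℝ (Fin d)) N] : Type _ :=
  ∀ y : N, TangentSpace (𝓡 d) y [⋀^Fin k]→L[ℝ] ℝ

/-- The expression of a field of forms in the preferred chart at `y₀`: its pullback under the
inverse of the chart, a field of forms on the target of the chart. -/
noncomputable def chartExpr {d k : ℕ} {N : Type*} [TopologicalSpace N]
    [ChartedSpace (EuclideanSpace ℝ (Fin d)) N] (α : FormField d k N) (y₀ : N)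
    (u : EuclideanSpace ℝ (Fin d)) : EuclideanSpace ℝ (Fin d) [⋀^Fin k]→L[ℝ] ℝ :=
  (α ((extChartAt (𝓡 d) y₀).symm u)).compContinuousLinearMap
    (mfderiv (𝓡 d) (𝓡 d) (extChartAt (𝓡 d) y₀).symm u)

/-- The field of forms is smooth. -/
def IsSmoothForm {d k : ℕ} {N : Type*} [TopologicalSpace N]
    [ChartedSpace (EuclideanSpace ℝ (Fin d)) N] (α : FormField d k N) : Prop :=
  ∀ y₀ : N, ContDiffOn ℝ ∞ (chartExpr α y₀) (extChartAt (𝓡 d) y₀).target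

/-- The (smooth) form is closed. -/
def IsClosedForm {d k : ℕ} {N : Type*} [TopologicalSpace N]
    [ChartedSpace (EuclideanSpace ℝ (Fin d)) N] (α : FormField d k N) : Prop :=
  ∀ y₀ : N, ∀ u ∈ (extChartAt (𝓡 d) y₀).target, extDeriv (chartExpr α y₀) u = 0

/-- `S` is a regular submanifold: it carries (for the subspace topology) a smooth structure such
that the inclusion is a smooth embedding. -/
def IsRegularSubmanifold {d : ℕ} {N : Type*} [TopologicalSpace N]
    [ChartedSpace (EuclideanSpace ℝ (Fin d)) N] (S : Set N) : Prop :=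
  ∃ (c : ℕ) (_ : ChartedSpace (EuclideanSpace ℝ (Fin c)) S),
    IsManifold (𝓡 c) ∞ S ∧ Manifold.IsSmoothEmbedding (𝓡 c) (𝓡 d) ∞ (Subtype.val : S → N)

/-- The tangent space `T_y S ⊆ T_y N` of a regular submanifold `S` at `y ∈ S`: the (span of the)
velocities at `y` of the smooth curves of `N` that run in `S`. -/
noncomputable def tangentTo {d : ℕ} {N : Type*} [TopologicalSpace N]
    [ChartedSpace (EuclideanSpace ℝ (Fin d)) N] (S : Set N) (y : N) :
    Submodule ℝ (TangentSpace (𝓡 d) y) :=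
  Submodule.span ℝ {v | ∃ c : ℝ → N, ContMDiffAt 𝓘(ℝ, ℝ) (𝓡 d) ∞ c 0 ∧
    (∀ᶠ t in 𝓝 (0 : ℝ), c t ∈ S) ∧
    tangentMap 𝓘(ℝ, ℝ) (𝓡 d) c ⟨0, (1 : ℝ)⟩ = (⟨y, v⟩ : TangentBundle (𝓡 d) N)}

end Manifold

/-! ### Systems and connections -/

section System

/-- A system `(F, Ω, ω = κ^*η)`: a fibred manifold `κ : F → M` with `dim M = m`,
`dim F = m + n`, a volume form `η` on `M`, and a closed `(m+1)`-form `Ω` on `F`. -/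
structure FieldSystem (m n : ℕ) (M F : Type*)
    [TopologicalSpace M] [ChartedSpace (EuclideanSpace ℝ (Fin m)) M]
    [TopologicalSpace F] [ChartedSpace (EuclideanSpace ℝ (Fin (m + n))) F] where
  κ : F → M
  κ_smooth : ContMDiff (𝓡 (m + n)) (𝓡 m) ∞ κ
  κ_surjective : Function.Surjective κ
  κ_submersion : ∀ y, Function.Surjective (mfderiv (𝓡 (m + n)) (𝓡 m) κ y)
  η : FormField m m M
  η_smooth : IsSmoothForm η
  η_ne_zero : ∀ x, η x ≠ 0
  Ω : FormField (m + n) (m + 1) F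
  Ω_smooth : IsSmoothForm Ω
  Ω_closed : IsClosedForm Ω

variable {m n : ℕ} {M F : Type*}
  [TopologicalSpace M] [ChartedSpace (EuclideanSpace ℝ (Fin m)) M]
  [TopologicalSpace F] [ChartedSpace (EuclideanSpace ℝ (Fin (m + n))) F]

namespace FieldSystem

/-- The tangent map `T_y κ` as a linear map. -/
noncomputable def dκ (S : FieldSystem m n M F) (y : F) :
    TangentSpace (𝓡 (m + n)) y →ₗ[ℝ] TangentSpace (𝓡 m) (S.κ y) :=
  (mfderiv (𝓡 (m + n)) (𝓡 m) S.κ y).toLinearMap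

/-- `Ω` vanishes when three of its arguments are vertical. -/
def VanishesOnThreeVertical (S : FieldSystem m n M F) : Prop :=
  ∀ (y : F) (v : Fin (m + 1) → TangentSpace (𝓡 (m + n)) y) (i j k : Fin (m + 1)),
    i ≠ j → i ≠ k → j ≠ k →
    v i ∈ LinearMap.ker (S.dκ y) → v j ∈ LinearMap.ker (S.dκ y) →
    v k ∈ LinearMap.ker (S.dκ y) → S.Ω y v = 0

end FieldSystem

variable [IsManifold (𝓡 (m + n)) ∞ F]

/-- An Ehresmann connection in `κ : F → M`, given by its horizontal lifts
`T_{κ(y)} M → T_y F`. Smoothness is that of the bundle map `v ↦ v^H` of `TF`. -/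
structure Connection (S : FieldSystem m n M F) where
  lift : ∀ y : F, TangentSpace (𝓡 m) (S.κ y) →ₗ[ℝ] TangentSpace (𝓡 (m + n)) y
  isSection : ∀ (y : F) (x : TangentSpace (𝓡 m) (S.κ y)), S.dκ y (lift y x) = x
  smooth : ContMDiff (𝓡 (m + n)).tangent (𝓡 (m + n)).tangent ∞
    (fun v : TangentBundle (𝓡 (m + n)) F =>
      (⟨v.proj, lift v.proj (S.dκ v.proj v.snd)⟩ : TangentBundle (𝓡 (m + n)) F))

/-- A basis of `T_x M`, the standard basis of the model space. (Only used to write down the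
`m`-vector `Y`, which does not depend on the basis.) -/
noncomputable def frame (m : ℕ) {M : Type*} [TopologicalSpace M]
    [ChartedSpace (EuclideanSpace ℝ (Fin m)) M] (x : M) :
    Module.Basis (Fin m) ℝ (TangentSpace (𝓡 m) x) :=
  (EuclideanSpace.basisFun (Fin m) ℝ).toBasis

namespace FieldSystem

variable (S : FieldSystem m n M F) (nabla : Connection S)

/-- The map `♭(y)` on `Lin(T_{κ(y)} M, C)`, for a subspace `C` of `T_y F`. -/
noncomputable def flatAt (y : F) (C : Submodule ℝ (TangentSpace (𝓡 (m + n)) y))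
    (h : TangentSpace (𝓡 m) (S.κ y) →ₗ[ℝ] C) : PairSpace (S.dκ y) (nabla.lift y) :=
  flat (frame m (S.κ y)) (S.η (S.κ y)).toAlternatingMap (S.Ω y).toAlternatingMap
    (S.dκ y) (nabla.lift y) C h

/-- The section `((Tκ_{H(∇)})⁻¹, -γ|_{V(κ)})` of the bundle with fibres
`Lin(T_{κ(y)} M, H_y(∇)) × V_y(κ)^*`. -/
noncomputable def targetAt (y : F) : PairSpace (S.dκ y) (nabla.lift y) :=
  target (frame m (S.κ y)) (S.η (S.κ y)).toAlternatingMap (S.Ω y).toAlternatingMap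
    (S.dκ y) (nabla.lift y)

/-- The orthogonal complement with respect to `Ω` and `∇` of the tangent space `T_y C`. -/
noncomputable def tangentOrth (C : Set F) (y : F) : Submodule ℝ (DualPairSpace (S.dκ y)) :=
  orthComplement (frame m (S.κ y)) (S.η (S.κ y)).toAlternatingMap (S.Ω y).toAlternatingMap
    (S.dκ y) (nabla.lift y) (tangentTo C y)

/-- The sequence of the constraint algorithm: `C₀ = F`, and `C_{i+1}` consists of the `y ∈ C_i`
for which there is `h : T_{κ(y)} M → T_y C_i` with `h^H` the horizontal lift and
`i(i(h^V ∘ T_yκ)Y)Ω = -γ` on `V_y(κ)`. -/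
def constraintSet : ℕ → Set F
  | 0 => Set.univ
  | i + 1 => {y | y ∈ constraintSet i ∧
      ∃ h : TangentSpace (𝓡 m) (S.κ y) →ₗ[ℝ] tangentTo (constraintSet i) y,
        S.flatAt nabla y (tangentTo (constraintSet i) y) h = S.targetAt nabla y}

/-- `h : T_{κ(y)} M → T_y C` solves the field equations at `y`: it is a section of `T_yκ`, and
`Ω(h X₁, …, h Xₘ, Y) = 0` for all `X₁, …, Xₘ ∈ T_{κ(y)} M` and `Y ∈ T_y F`. -/
def SolvesFieldEquations (y : F) (C : Submodule ℝ (TangentSpace (𝓡 (m + n)) y))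
    (h : TangentSpace (𝓡 m) (S.κ y) →ₗ[ℝ] C) : Prop :=
  (∀ x, S.dκ y (h x) = x) ∧
  ∀ (X : Fin m → TangentSpace (𝓡 m) (S.κ y)) (Y : TangentSpace (𝓡 (m + n)) y),
    contract (S.Ω y).toAlternatingMap (fun α => (h (X α) : TangentSpace (𝓡 (m + n)) y)) Y = 0

variable [IsManifold (𝓡 m) ∞ M] in
/-- Smoothness over `U` of a section `y ↦ (h*_y, Z_y)` of the bundle with fibres
`(T_{κ(y)} M ⊗ V_y(κ)⁰) × V_y(κ)`: `h*` is a smooth bundle map `TF → TM` over `κ`, and `Z` is a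
smooth vector field. -/
def IsSmoothDualSection (U : Set F) (s : ∀ y : F, DualPairSpace (S.dκ y)) : Prop :=
  ContMDiffOn (𝓡 (m + n)).tangent (𝓡 m).tangent ∞
    (fun v : TangentBundle (𝓡 (m + n)) F =>
      (⟨S.κ v.proj, ((s v.proj).1 : TangentSpace (𝓡 (m + n)) v.proj →ₗ[ℝ]
        TangentSpace (𝓡 m) (S.κ v.proj)) v.snd⟩ : TangentBundle (𝓡 m) M))
    {v | v.proj ∈ U} ∧
  ContMDiffOn (𝓡 (m + n)) (𝓡 (m + n)).tangent ∞
    (fun y : F => (⟨y, ((s y).2 : TangentSpace (𝓡 (m + n)) y)⟩ : TangentBundle (𝓡 (m + n)) F)) U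

/-- The function `ξ` obtained by pairing a section `(h*, Z)` with
`((Tκ_{H(∇)})⁻¹, -γ|_{V(κ)})`. -/
noncomputable def constraint (s : ∀ y : F, DualPairSpace (S.dκ y)) (y : F) : ℝ :=
  pairing (S.dκ y) (nabla.lift y) (s y) (S.targetAt nabla y)

end FieldSystem

end System

end PreMultisymplectic

/-!
Let `h` be a section of `T_yκ` and write `h = nab + A`, with `nab` the horizontal lift and `A`
vertical. In the expansion of `Ω(h e₁, …, h eₘ, Z)` for a vertical `Z`, the terms with two or more
factors `A` have three vertical arguments and vanish. What remains is, up to the factor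
`η(e₁, …, eₘ)`, the sum of `γ(Z)` and of the second component of `♭(h)` at `Z`. On the image of
`h` the contraction vanishes anyway, because `m + 1` vectors of the `m`-dimensional space `T M` are
linearly dependent. Hence `♭(h) = σ(y)` says that `h` solves the field equations. As the pairing is
perfect in finite dimension, the image of the linear map `♭` is the common zero set of its
annihilator, which gives the intrinsic description and the constraints.

The constraints are smooth because the trace and `γ` can be computed in a local frame of `T M`
pulled back along `κ`: the horizontal lift of a smooth field `X` along `κ` is the horizontal part
of any smooth vector field projecting to `X`, and such a field exists locally as `κ` is a
submersion.
-/

namespace PreMultisymplectic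

section Linear

variable {m : ℕ} {E W : Type*} [AddCommGroup E] [Module ℝ E] [AddCommGroup W] [Module ℝ W]

/-- The form `Ω` vanishes as soon as three of its arguments lie in `V`. With `V = ker T_yκ` this is
`FieldSystem.VanishesOnThreeVertical` at the point `y`. -/
def VanishesOnThreeIn {k : ℕ} (V : Submodule ℝ W) (Ω : W [⋀^Fin k]→ₗ[ℝ] ℝ) : Prop :=
  ∀ (v : Fin k → W) (i j l : Fin k), i ≠ j → i ≠ l → j ≠ l → v i ∈ V → v j ∈ V → v l ∈ V →
    Ω v = 0

theorem contract_apply (Ω : W [⋀^Fin (m + 1)]→ₗ[ℝ] ℝ) (w : Fin m → W) (v : W) :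
    contract Ω w v = Ω (Fin.snoc w v) := rfl

theorem contract_apply_eq_curryLeft (Ω : W [⋀^Fin (m + 1)]→ₗ[ℝ] ℝ) (w : Fin m → W) (v : W) :
    contract Ω w v = ((-1 : ℤ) ^ m • Ω.curryLeft v) w := by
  rw [contract_apply, ← Fin.insertNth_last', Ω.map_insertNth]
  simp [Matrix.vecCons]

/-- Only the terms of degree at most one in `b` survive: the others have two arguments `b α` in
`V`, besides `Z`. -/
theorem contract_add_apply_of_mem {V : Submodule ℝ W} {Ω : W [⋀^Fin (m + 1)]→ₗ[ℝ] ℝ}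
    (hΩ : VanishesOnThreeIn V Ω) (a : Fin m → W) {b : Fin m → W} (hb : ∀ α, b α ∈ V) {Z : W}
    (hZ : Z ∈ V) :
    contract Ω (a + b) Z =
      contract Ω a Z + ∑ α, contract Ω (Function.update a α (b α)) Z := by
  have higher_terms_eq_zero (s : Finset (Fin m)) (hs : 2 ≤ s.card) :
      contract Ω (s.piecewise b a) Z = 0 := by
    obtain ⟨i, hi, j, hj, hij⟩ := Finset.one_lt_card.1 hs
    exact hΩ _ i.castSucc j.castSucc (Fin.last m) (by simpa using hij) (Fin.castSucc_lt_last i).ne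
      (Fin.castSucc_lt_last j).ne (by simpa [hi] using hb i) (by simpa [hj] using hb j)
      (by simpa using hZ)
  have expansion := congrArg (· Z)
    (Ω.toMultilinearMap.curryRight.map_add_eq_map_add_linearDeriv_add a b)
  simp only [LinearMap.add_apply, LinearMap.sum_apply, MultilinearMap.linearDeriv_apply]
    at expansion
  exact expansion.trans (add_eq_left.2 (Finset.sum_eq_zero fun s hs =>
    higher_terms_eq_zero s (Finset.mem_filter.1 hs).2))

theorem contract_comp_apply_self_eq_zero [FiniteDimensional ℝ E] (hE : Module.finrank ℝ E ≤ m)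
    (Ω : W [⋀^Fin (m + 1)]→ₗ[ℝ] ℝ) (h : E →ₗ[ℝ] W) (X : Fin m → E) (x : E) :
    contract Ω (h ∘ X) (h x) = 0 := by
  have not_linearIndependent : ¬ LinearIndependent ℝ (Fin.snoc X x : Fin (m + 1) → E) :=
    fun hli => by
      have := hli.fintype_card_le_finrank
      rw [Fintype.card_fin] at this
      omega
  rw [contract_apply, ← Fin.comp_snoc]
  exact (Ω.compLinearMap h).map_linearDependent _ not_linearIndependent

theorem contract_comp_eq_zero_of_basis (e : Module.Basis (Fin m) ℝ E)
    {Ω : W [⋀^Fin (m + 1)]→ₗ[ℝ] ℝ} {h : E →ₗ[ℝ] W} {Y : W} (hY : contract Ω (h ∘ e) Y = 0)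
    (X : Fin m → E) : contract Ω (h ∘ X) Y = 0 := by
  let g := ((-1 : ℤ) ^ m • Ω.curryLeft Y).compLinearMap h
  have contract_eq (X : Fin m → E) : contract Ω (h ∘ X) Y = g X :=
    contract_apply_eq_curryLeft Ω (h ∘ X) Y
  have : g = 0 := (g.map_basis_eq_zero_iff e).1 ((contract_eq e).symm.trans hY)
  rw [contract_eq, this, AlternatingMap.zero_apply]

theorem gammaForm_eq_of_basis (e b : Module.Basis (Fin m) ℝ E) (η : E [⋀^Fin m]→ₗ[ℝ] ℝ)
    (Ω : W [⋀^Fin (m + 1)]→ₗ[ℝ] ℝ) (nab : E →ₗ[ℝ] W) :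
    gammaForm e η Ω nab = gammaForm b η Ω nab := by
  ext Z
  let g := ((-1 : ℤ) ^ m • Ω.curryLeft Z).compLinearMap nab
  have gammaForm_apply (b : Module.Basis (Fin m) ℝ E) :
      gammaForm b η Ω nab Z = (η b)⁻¹ * g b :=
    congrArg ((η b)⁻¹ * ·) (contract_apply_eq_curryLeft Ω (nab ∘ b) Z)
  have map_basis (f : E [⋀^Fin m]→ₗ[ℝ] ℝ) : f b = f e * e.det b :=
    congrArg (· b) (f.eq_smul_basis_det e)
  have det_ne_zero : e.det b ≠ 0 := (e.isUnit_det b).ne_zero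
  rw [gammaForm_apply, gammaForm_apply, map_basis η, map_basis g]
  field_simp

variable {σ : W →ₗ[ℝ] E} {nab : E →ₗ[ℝ] W}

theorem vertTilde_apply_section (hσ : ∀ x, σ (nab x) = x) (h : E →ₗ[ℝ] W) (x : E) :
    vertTilde σ nab h (nab x) = h x - nab (σ (h x)) := by
  simp [vertTilde, vertProj, horProj, hσ]

theorem gammaForm_add_derivedForm_apply (hσ : ∀ x, σ (nab x) = x) (e : Module.Basis (Fin m) ℝ E)
    (η : E [⋀^Fin m]→ₗ[ℝ] ℝ) {Ω : W [⋀^Fin (m + 1)]→ₗ[ℝ] ℝ}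
    (hΩ : VanishesOnThreeIn (LinearMap.ker σ) Ω) {h : E →ₗ[ℝ] W} (hh : ∀ x, σ (h x) = x) {Z : W}
    (hZ : Z ∈ LinearMap.ker σ) :
    gammaForm e η Ω nab Z + derivedForm e η Ω nab (vertTilde σ nab h) Z =
      (η e)⁻¹ * contract Ω (h ∘ e) Z := by
  have vertTilde_eq (α : Fin m) : vertTilde σ nab h (nab (e α)) = h (e α) - nab (e α) := by
    rw [vertTilde_apply_section hσ, hh]
  have vertical (α : Fin m) : vertTilde σ nab h (nab (e α)) ∈ LinearMap.ker σ := by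
    rw [vertTilde_eq, LinearMap.mem_ker, map_sub, hh, hσ, sub_self]
  have decomposition :
      (fun α => nab (e α)) + (fun α => vertTilde σ nab h (nab (e α))) = h ∘ e := by
    funext α
    simp [vertTilde_eq]
  rw [← decomposition, contract_add_apply_of_mem hΩ _ vertical hZ]
  simp only [gammaForm, derivedForm, LinearMap.smul_apply, LinearMap.sum_apply, smul_eq_mul,
    mul_add]

theorem flat_fst_eq_target_fst_iff (hσ : ∀ x, σ (nab x) = x) {e : Module.Basis (Fin m) ℝ E}
    {η : E [⋀^Fin m]→ₗ[ℝ] ℝ} {Ω : W [⋀^Fin (m + 1)]→ₗ[ℝ] ℝ} {C : Submodule ℝ W}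
    (h : E →ₗ[ℝ] C) :
    (flat e η Ω σ nab C h).1 = (target e η Ω σ nab).1 ↔ ∀ x, σ (h x) = x := by
  have nab_injective : Function.Injective nab := Function.LeftInverse.injective hσ
  rw [LinearMap.ext_iff]
  exact forall_congr' fun x => Subtype.ext_iff.trans nab_injective.eq_iff

theorem flat_snd_eq_target_snd_iff (hσ : ∀ x, σ (nab x) = x) {e : Module.Basis (Fin m) ℝ E}
    {η : E [⋀^Fin m]→ₗ[ℝ] ℝ} (hη : η ≠ 0) {Ω : W [⋀^Fin (m + 1)]→ₗ[ℝ] ℝ}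
    (hΩ : VanishesOnThreeIn (LinearMap.ker σ) Ω) {C : Submodule ℝ W} {h : E →ₗ[ℝ] C}
    (hh : ∀ x, σ (h x) = x) :
    (flat e η Ω σ nab C h).2 = (target e η Ω σ nab).2 ↔
      ∀ Z ∈ LinearMap.ker σ, contract Ω ((C.subtype ∘ₗ h) ∘ e) Z = 0 := by
  have volume_ne_zero : (η e)⁻¹ ≠ 0 := inv_ne_zero ((η.map_basis_ne_zero_iff e).2 hη)
  rw [LinearMap.ext_iff, Subtype.forall]
  refine forall₂_congr fun Z hZ => ?_
  calc derivedForm e η Ω nab (vertTilde σ nab (C.subtype ∘ₗ h)) Z = -gammaForm e η Ω nab Z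
    _ ↔ (η e)⁻¹ * contract Ω ((C.subtype ∘ₗ h) ∘ e) Z = 0 := by
      rw [← gammaForm_add_derivedForm_apply hσ e η hΩ hh hZ, add_comm, add_eq_zero_iff_eq_neg]
    _ ↔ contract Ω ((C.subtype ∘ₗ h) ∘ e) Z = 0 := mul_eq_zero_iff_left volume_ne_zero

theorem flat_eq_target_iff (hσ : ∀ x, σ (nab x) = x) {e : Module.Basis (Fin m) ℝ E}
    {η : E [⋀^Fin m]→ₗ[ℝ] ℝ} (hη : η ≠ 0) {Ω : W [⋀^Fin (m + 1)]→ₗ[ℝ] ℝ}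
    (hΩ : VanishesOnThreeIn (LinearMap.ker σ) Ω) {C : Submodule ℝ W} (h : E →ₗ[ℝ] C) :
    flat e η Ω σ nab C h = target e η Ω σ nab ↔
      (∀ x, σ (h x) = x) ∧
        ∀ (X : Fin m → E) (Y : W), contract Ω (fun α => (h (X α) : W)) Y = 0 := by
  rw [Prod.ext_iff, flat_fst_eq_target_fst_iff hσ]
  refine and_congr_right fun hh => ?_
  rw [flat_snd_eq_target_snd_iff hσ hη hΩ hh]
  refine ⟨fun H X Y => ?_, fun H Z _ => H e Z⟩
  have : FiniteDimensional ℝ E := e.finiteDimensional_of_finite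
  have horizontal : contract Ω ((C.subtype ∘ₗ h) ∘ e) (h (σ Y)) = 0 :=
    contract_comp_apply_self_eq_zero (by simp [Module.finrank_eq_card_basis e]) ..
  have vertical : Y - h (σ Y) ∈ LinearMap.ker σ := by
    rw [LinearMap.mem_ker, map_sub, hh, sub_self]
  refine contract_comp_eq_zero_of_basis e (h := C.subtype ∘ₗ h) ?_ X
  rw [← sub_add_cancel Y (h (σ Y) : W), map_add, H _ vertical, horizontal, add_zero]

theorem derivedForm_add (e : Module.Basis (Fin m) ℝ E) (η : E [⋀^Fin m]→ₗ[ℝ] ℝ)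
    (Ω : W [⋀^Fin (m + 1)]→ₗ[ℝ] ℝ) (nab : E →ₗ[ℝ] W) (A B : W →ₗ[ℝ] W) :
    derivedForm e η Ω nab (A + B) = derivedForm e η Ω nab A + derivedForm e η Ω nab B := by
  simp only [derivedForm, contract, LinearMap.add_apply, MultilinearMap.map_update_add,
    Finset.sum_add_distrib, smul_add]

theorem derivedForm_smul (e : Module.Basis (Fin m) ℝ E) (η : E [⋀^Fin m]→ₗ[ℝ] ℝ)
    (Ω : W [⋀^Fin (m + 1)]→ₗ[ℝ] ℝ) (nab : E →ₗ[ℝ] W) (c : ℝ) (A : W →ₗ[ℝ] W) :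
    derivedForm e η Ω nab (c • A) = c • derivedForm e η Ω nab A := by
  simp only [derivedForm, contract, LinearMap.smul_apply, MultilinearMap.map_update_smul,
    ← Finset.smul_sum, smul_comm c]

/-- The map `♭` bundled as a linear map, so that its image is a subspace. -/
noncomputable def flatLinear (e : Module.Basis (Fin m) ℝ E) (η : E [⋀^Fin m]→ₗ[ℝ] ℝ)
    (Ω : W [⋀^Fin (m + 1)]→ₗ[ℝ] ℝ) (σ : W →ₗ[ℝ] E) (nab : E →ₗ[ℝ] W) (C : Submodule ℝ W) :
    (E →ₗ[ℝ] C) →ₗ[ℝ] PairSpace σ nab where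
  toFun := flat e η Ω σ nab C
  map_add' h k := by
    simp only [flat, vertTilde, LinearMap.comp_add, LinearMap.add_comp, derivedForm_add]
    rfl
  map_smul' c h := by
    simp only [flat, vertTilde, LinearMap.comp_smul, LinearMap.smul_comp, derivedForm_smul]
    rfl

theorem forall_mem_span_range_eq_zero_iff {R M N ι : Type*} [Semiring R] [AddCommMonoid M]
    [Module R M] [AddCommMonoid N] [Module R N] (f : M →ₗ[R] N) (s : ι → M) :
    (∀ p ∈ Submodule.span R (Set.range s), f p = 0) ↔ ∀ j, f (s j) = 0 :=
  (Submodule.span_le (p := LinearMap.ker f)).trans Set.range_subset_iff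

theorem exists_forall_trace_comp_eq {R M N : Type*} [CommRing R] [AddCommGroup M] [Module R M]
    [Module.Free R M] [Module.Finite R M] [AddCommGroup N] [Module R N]
    (f : (M →ₗ[R] N) →ₗ[R] R) :
    ∃ A : N →ₗ[R] M, ∀ u : M →ₗ[R] N, LinearMap.trace R M (A ∘ₗ u) = f u := by
  let b := Module.Free.chooseBasis R M
  let A : N →ₗ[R] M := ∑ i, (f ∘ₗ LinearMap.smulRightₗ (b.coord i)).smulRight (b i)
  refine ⟨A, fun u => ?_⟩
  have expansion : u = ∑ i, (b.coord i).smulRight (u (b i)) := by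
    refine b.ext fun j => ?_
    simp [Finsupp.single_apply]
  calc LinearMap.trace R M (A ∘ₗ u) = ∑ i, f ((b.coord i).smulRight (u (b i))) := by
        rw [LinearMap.trace_eq_matrix_trace R b, Matrix.trace]
        refine Finset.sum_congr rfl fun i _ => ?_
        simp [LinearMap.toMatrix_apply, A, Finsupp.single_apply]
    _ = f u := by rw [← map_sum, ← expansion]

theorem horProj_comp_subtype (hσ : ∀ x, σ (nab x) = x) :
    horProj σ nab ∘ₗ (LinearMap.range nab).subtype = LinearMap.id := by
  ext ⟨_, x, rfl⟩
  exact congrArg nab (hσ x)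

theorem comp_horProj_mem_horDual (A : LinearMap.range nab →ₗ[ℝ] E) :
    A ∘ₗ horProj σ nab ∈ horDual σ := fun v hv => by
  have : horProj σ nab v = 0 := (congrArg nab.rangeRestrict hv).trans (map_zero _)
  rw [LinearMap.comp_apply, this, map_zero]

theorem pairing_surjective [FiniteDimensional ℝ E] [FiniteDimensional ℝ W]
    (hσ : ∀ x, σ (nab x) = x) : Function.Surjective (pairing σ nab) := fun f => by
  obtain ⟨A, hA⟩ := exists_forall_trace_comp_eq (f ∘ₗ LinearMap.inl ℝ _ _)
  obtain ⟨Z, hZ⟩ := (Module.evalEquiv ℝ (LinearMap.ker σ)).surjective (f ∘ₗ LinearMap.inr ℝ _ _)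
  refine ⟨(⟨A ∘ₗ horProj σ nab, comp_horProj_mem_horDual A⟩, Z), LinearMap.ext fun q => ?_⟩
  calc LinearMap.trace ℝ E ((A ∘ₗ horProj σ nab) ∘ₗ (LinearMap.range nab).subtype ∘ₗ q.1) + q.2 Z
      = LinearMap.trace ℝ E (A ∘ₗ q.1) + q.2 Z := by
        rw [LinearMap.comp_assoc, ← LinearMap.comp_assoc q.1, horProj_comp_subtype hσ,
          LinearMap.id_comp]
    _ = f (q.1, 0) + f (0, q.2) := congrArg₂ (· + ·) (hA q.1) (LinearMap.congr_fun hZ q.2)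
    _ = f q := by rw [← map_add, Prod.mk_add_mk, add_zero, zero_add]

theorem exists_flat_eq_iff [FiniteDimensional ℝ E] [FiniteDimensional ℝ W]
    (hσ : ∀ x, σ (nab x) = x) {e : Module.Basis (Fin m) ℝ E}
    {η : E [⋀^Fin m]→ₗ[ℝ] ℝ} {Ω : W [⋀^Fin (m + 1)]→ₗ[ℝ] ℝ} {C : Submodule ℝ W}
    (q : PairSpace σ nab) :
    (∃ h, flat e η Ω σ nab C h = q) ↔
      ∀ p ∈ orthComplement e η Ω σ nab C, pairing σ nab p q = 0 := by
  refine ⟨?_, fun H => ?_⟩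
  · rintro ⟨h, rfl⟩ p hp
    exact hp h
  · by_contra hq
    have not_mem_range : q ∉ LinearMap.range (flatLinear e η Ω σ nab C) := hq
    obtain ⟨f, hfq, hf⟩ := Submodule.exists_le_ker_of_notMem not_mem_range
    obtain ⟨p, rfl⟩ := pairing_surjective hσ f
    exact hfq (H p fun h => hf ⟨h, rfl⟩)

end Linear

section Smooth

open Bundle ContinuousLinearMap

section Generic

variable {𝕜 M EM HM : Type*} [NontriviallyNormedField 𝕜] [NormedAddCommGroup EM] [NormedSpace 𝕜 EM]
  [TopologicalSpace HM] {IM : ModelWithCorners 𝕜 EM HM} [TopologicalSpace M] [ChartedSpace HM M]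
  {n : ℕ∞ω} {x₀ : M}

theorem contMDiffAt_continuousAlternatingMap_apply {ι V G : Type*} [Fintype ι]
    [NormedAddCommGroup V] [NormedSpace 𝕜 V] [NormedAddCommGroup G] [NormedSpace 𝕜 G]
    {A : M → V [⋀^ι]→L[𝕜] G} {v : M → ι → V}
    (hA : ContMDiffAt IM 𝓘(𝕜, V [⋀^ι]→L[𝕜] G) n A x₀)
    (hv : ∀ i, ContMDiffAt IM 𝓘(𝕜, V) n (fun x => v x i) x₀) :
    ContMDiffAt IM 𝓘(𝕜, G) n (fun x => A x (v x)) x₀ := by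
  have evaluation : ContDiffAt 𝕜 n (fun p : (V [⋀^ι]→L[𝕜] G) × (ι → V) => p.1 p.2)
      (A x₀, v x₀) :=
    (ContinuousLinearMap.cpolynomialAt_uncurry_of_multilinear (x := (A x₀, v x₀))
      (ContinuousAlternatingMap.toContinuousMultilinearMapCLM 𝕜 :
        (V [⋀^ι]→L[𝕜] G) →L[𝕜] ContinuousMultilinearMap 𝕜 (fun _ : ι => V) G)).contDiffAt
  exact evaluation.contMDiffAt.comp x₀ (hA.prodMk_space (contMDiffAt_pi_space.2 hv))

theorem exists_contMDiffAt_rightInverse [CompleteSpace 𝕜] {F₁ F₂ : Type*} [NormedAddCommGroup F₁]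
    [NormedSpace 𝕜 F₁] [NormedAddCommGroup F₂] [NormedSpace 𝕜 F₂] [FiniteDimensional 𝕜 F₂]
    {D : M → F₁ →L[𝕜] F₂} (hD : ContMDiffAt IM 𝓘(𝕜, F₁ →L[𝕜] F₂) n D x₀)
    (hsurj : Function.Surjective (D x₀)) :
    ∃ R : M → F₂ →L[𝕜] F₁, ContMDiffAt IM 𝓘(𝕜, F₂ →L[𝕜] F₁) n R x₀ ∧
      ∀ᶠ x in 𝓝 x₀, D x ∘L R x = .id 𝕜 F₂ := by
  have : CompleteSpace F₂ := FiniteDimensional.complete 𝕜 F₂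
  obtain ⟨R₀, hR₀⟩ := (D x₀).exists_rightInverse_of_surjective (LinearMap.range_eq_top.2 hsurj)
  have comp_smooth : ContMDiffAt IM 𝓘(𝕜, F₂ →L[𝕜] F₂) n (fun x => D x ∘L R₀) x₀ :=
    hD.clm_comp contMDiffAt_const
  have inverse_smooth : ContMDiffAt IM 𝓘(𝕜, F₂ →L[𝕜] F₂) n (fun x => (D x ∘L R₀).inverse) x₀ := by
    have isInvertible : (D x₀ ∘L R₀).IsInvertible := ⟨.refl 𝕜 F₂, hR₀.symm⟩
    exact isInvertible.contDiffAt_map_inverse.contMDiffAt.comp x₀ comp_smooth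
  refine ⟨fun x => R₀ ∘L (D x ∘L R₀).inverse, contMDiffAt_const.clm_comp inverse_smooth, ?_⟩
  have eventually_isInvertible : ∀ᶠ x in 𝓝 x₀, (D x ∘L R₀).IsInvertible :=
    comp_smooth.continuousAt.eventually_mem (by
      rw [hR₀]
      exact (ContinuousLinearEquiv.refl 𝕜 F₂).nhds)
  filter_upwards [eventually_isInvertible] with x hx
  exact hx.self_comp_inverse

end Generic

section Bundles

theorem eventually_mem_baseSet_trivializationAt {M B F : Type*} [TopologicalSpace M]
    [TopologicalSpace B] [TopologicalSpace F] (E : B → Type*) [TopologicalSpace (TotalSpace F E)]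
    [∀ x, TopologicalSpace (E x)] [FiberBundle F E] {b : M → B} {x₀ : M}
    (hb : ContinuousAt b x₀) :
    ∀ᶠ x in 𝓝 x₀, b x ∈ (trivializationAt F E (b x₀)).baseSet :=
  hb.eventually_mem ((trivializationAt F E (b x₀)).open_baseSet.mem_nhds
    (FiberBundle.mem_baseSet_trivializationAt' (b x₀)))

variable {𝕜 M EM HM B₁ EB₁ HB₁ B₂ EB₂ HB₂ F₁ F₂ : Type*} [NontriviallyNormedField 𝕜]
  [NormedAddCommGroup EM] [NormedSpace 𝕜 EM] [TopologicalSpace HM]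
  {IM : ModelWithCorners 𝕜 EM HM} [TopologicalSpace M] [ChartedSpace HM M]
  [NormedAddCommGroup EB₁] [NormedSpace 𝕜 EB₁] [TopologicalSpace HB₁]
  {IB₁ : ModelWithCorners 𝕜 EB₁ HB₁} [TopologicalSpace B₁] [ChartedSpace HB₁ B₁]
  [NormedAddCommGroup EB₂] [NormedSpace 𝕜 EB₂] [TopologicalSpace HB₂]
  {IB₂ : ModelWithCorners 𝕜 EB₂ HB₂} [TopologicalSpace B₂] [ChartedSpace HB₂ B₂]
  [NormedAddCommGroup F₁] [NormedSpace 𝕜 F₁] {E₁ : B₁ → Type*} [∀ x, AddCommGroup (E₁ x)]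
  [∀ x, Module 𝕜 (E₁ x)] [∀ x, TopologicalSpace (E₁ x)] [TopologicalSpace (TotalSpace F₁ E₁)]
  [FiberBundle F₁ E₁] [VectorBundle 𝕜 F₁ E₁]
  [NormedAddCommGroup F₂] [NormedSpace 𝕜 F₂] {E₂ : B₂ → Type*} [∀ x, AddCommGroup (E₂ x)]
  [∀ x, Module 𝕜 (E₂ x)] [∀ x, TopologicalSpace (E₂ x)] [TopologicalSpace (TotalSpace F₂ E₂)]
  [FiberBundle F₂ E₂] [VectorBundle 𝕜 F₂ E₂]
  {n : ℕ∞ω} {x₀ : M} {b₁ : M → B₁} {b₂ : M → B₂}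

theorem exists_contMDiffAt_lift_of_surjective [CompleteSpace 𝕜] [FiniteDimensional 𝕜 F₂]
    {φ : ∀ x, E₁ (b₁ x) →L[𝕜] E₂ (b₂ x)} (hb₁ : ContMDiffAt IM IB₁ n b₁ x₀)
    (hφ : ContMDiffAt IM 𝓘(𝕜, F₁ →L[𝕜] F₂) n
      (fun x => inCoordinates F₁ E₁ F₂ E₂ (b₁ x₀) (b₁ x) (b₂ x₀) (b₂ x) (φ x)) x₀)
    (hsurj : Function.Surjective (φ x₀)) {X : ∀ x, E₂ (b₂ x)}
    (hX : ContMDiffAt IM (IB₂.prod 𝓘(𝕜, F₂)) n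
      (fun x => (⟨b₂ x, X x⟩ : TotalSpace F₂ E₂)) x₀) :
    ∃ W : ∀ x, E₁ (b₁ x),
      ContMDiffAt IM (IB₁.prod 𝓘(𝕜, F₁)) n (fun x => (⟨b₁ x, W x⟩ : TotalSpace F₁ E₁)) x₀ ∧
        ∀ᶠ x in 𝓝 x₀, φ x (W x) = X x := by
  rw [contMDiffAt_totalSpace] at hX
  obtain ⟨hb₂, hX⟩ := hX
  let e₁ := trivializationAt F₁ E₁ (b₁ x₀)
  let e₂ := trivializationAt F₂ E₂ (b₂ x₀)
  have mem_baseSet₁ : ∀ᶠ x in 𝓝 x₀, b₁ x ∈ e₁.baseSet :=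
    eventually_mem_baseSet_trivializationAt E₁ hb₁.continuousAt
  have mem_baseSet₂ : ∀ᶠ x in 𝓝 x₀, b₂ x ∈ e₂.baseSet :=
    eventually_mem_baseSet_trivializationAt E₂ hb₂.continuousAt
  have coordinates_surjective : Function.Surjective
      (inCoordinates F₁ E₁ F₂ E₂ (b₁ x₀) (b₁ x₀) (b₂ x₀) (b₂ x₀) (φ x₀)) := by
    rw [inCoordinates_eq mem_baseSet₁.self_of_nhds mem_baseSet₂.self_of_nhds]
    exact (e₂.continuousLinearEquivAt 𝕜 _ mem_baseSet₂.self_of_nhds).surjective.comp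
      (hsurj.comp (e₁.continuousLinearEquivAt 𝕜 _ mem_baseSet₁.self_of_nhds).symm.surjective)
  obtain ⟨R, R_smooth, hR⟩ := exists_contMDiffAt_rightInverse hφ coordinates_surjective
  let w (x : M) : F₁ := R x (e₂ ⟨b₂ x, X x⟩).2
  refine ⟨fun x => e₁.symmL 𝕜 (b₁ x) (w x), (contMDiffAt_totalSpace).2 ⟨hb₁, ?_⟩, ?_⟩
  · refine (R_smooth.clm_apply hX).congr_of_eventuallyEq ?_
    filter_upwards [mem_baseSet₁] with x hx
    rw [Trivialization.symmL_apply (R := 𝕜) e₁ hx]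
    exact congrArg Prod.snd (e₁.apply_mk_symm hx (w x))
  · filter_upwards [hR, mem_baseSet₂] with x hx hx₂
    have : e₂.continuousLinearMapAt 𝕜 (b₂ x) (φ x (e₁.symmL 𝕜 (b₁ x) (w x))) =
        e₂.continuousLinearMapAt 𝕜 (b₂ x) (X x) :=
      (DFunLike.congr_fun hx _).trans (congrFun (e₂.coe_linearMapAt_of_mem hx₂) (X x)).symm
    rw [← e₂.symmL_continuousLinearMapAt (R := 𝕜) hx₂ (X x), ← this,
      e₂.symmL_continuousLinearMapAt hx₂]

theorem contMDiffAt_trace_of_forall_contMDiffAt [CompleteSpace 𝕜] [FiniteDimensional 𝕜 F₁]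
    [ContMDiffVectorBundle n F₁ E₁ IB₁]
    {T : ∀ x, E₁ (b₁ x) →ₗ[𝕜] E₁ (b₁ x)} (hb₁ : ContMDiffAt IM IB₁ n b₁ x₀)
    (hT : ∀ X : ∀ x, E₁ (b₁ x),
      ContMDiffAt IM (IB₁.prod 𝓘(𝕜, F₁)) n (fun x => (⟨b₁ x, X x⟩ : TotalSpace F₁ E₁)) x₀ →
      ContMDiffAt IM (IB₁.prod 𝓘(𝕜, F₁)) n
        (fun x => (⟨b₁ x, T x (X x)⟩ : TotalSpace F₁ E₁)) x₀) :
    ContMDiffAt IM 𝓘(𝕜, 𝕜) n (fun x => LinearMap.trace 𝕜 (E₁ (b₁ x)) (T x)) x₀ := by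
  let e := trivializationAt F₁ E₁ (b₁ x₀)
  let b := Module.finBasis 𝕜 F₁
  have entry_smooth (i : Fin (Module.finrank 𝕜 F₁)) : ContMDiffAt IM 𝓘(𝕜, 𝕜) n
      (fun x => b.coord i (e ⟨b₁ x, T x (e.localFrame b i (b₁ x))⟩).2) x₀ := by
    have frame_smooth := (contMDiffAt_localFrame_of_mem (I := IB₁) n e b i
      (FiberBundle.mem_baseSet_trivializationAt' (b₁ x₀))).comp x₀ hb₁
    exact ((b.coord i).toContinuousLinearMap.contMDiff.contMDiffAt).comp x₀
      (contMDiffAt_totalSpace.1 (hT _ frame_smooth)).2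
  refine (contMDiffAt_finsetSum (t := Finset.univ)
    fun i _ => entry_smooth i).congr_of_eventuallyEq ?_
  filter_upwards [eventually_mem_baseSet_trivializationAt (F := F₁) E₁ hb₁.continuousAt] with x hx
  rw [LinearMap.trace_eq_matrix_trace 𝕜 (e.basisAt b hx), Matrix.trace]
  refine Finset.sum_congr rfl fun i _ => ?_
  rw [Matrix.diag_apply, LinearMap.toMatrix_apply, e.localFrame_apply_of_mem_baseSet b hx]
  simp [Trivialization.basisAt]

end Bundles

section Forms

variable {d k : ℕ} {N M EM HM : Type*}
  [TopologicalSpace N] [ChartedSpace (EuclideanSpace ℝ (Fin d)) N]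
  [NormedAddCommGroup EM] [NormedSpace ℝ EM] [TopologicalSpace HM]
  {IM : ModelWithCorners ℝ EM HM} [TopologicalSpace M] [ChartedSpace HM M]

theorem chartExpr_apply [IsManifold (𝓡 d) 1 N] (α : FormField d k N) {y₀ y : N}
    (hy : y ∈ (chartAt (EuclideanSpace ℝ (Fin d)) y₀).source)
    (v : Fin k → TangentSpace (𝓡 d) y) :
    chartExpr α y₀ (extChartAt (𝓡 d) y₀ y) (fun i =>
      (trivializationAt (EuclideanSpace ℝ (Fin d)) (TangentSpace (𝓡 d)) y₀).continuousLinearMapAt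
        ℝ y (v i)) = α y v := by
  let e := trivializationAt (EuclideanSpace ℝ (Fin d)) (TangentSpace (𝓡 d)) y₀
  have symmL_eq : e.symmL ℝ y =
      mfderiv (𝓡 d) (𝓡 d) (extChartAt (𝓡 d) y₀).symm (extChartAt (𝓡 d) y₀ y) := by
    rw [TangentBundle.symmL_trivializationAt hy, ModelWithCorners.range_eq_univ,
      mfderivWithin_univ]
  have compContinuousLinearMap_apply {z : N} (hz : z = y)
      (T : EuclideanSpace ℝ (Fin d) →L[ℝ] EuclideanSpace ℝ (Fin d))
      (w : Fin k → EuclideanSpace ℝ (Fin d)) :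
      (α z).compContinuousLinearMap T w = α y fun i => T (w i) := by
    subst hz
    rfl
  have left_inv : (extChartAt (𝓡 d) y₀).symm (extChartAt (𝓡 d) y₀ y) = y :=
    (extChartAt (𝓡 d) y₀).left_inv (by rwa [extChartAt_source])
  refine (compContinuousLinearMap_apply left_inv _ _).trans (congrArg (α y) (funext fun i => ?_))
  rw [← symmL_eq]
  exact e.symmL_continuousLinearMapAt hy (v i)

theorem contMDiffAt_formField_apply [IsManifold (𝓡 d) ∞ N] {α : FormField d k N}
    (hα : IsSmoothForm α) {g : M → N} {x₀ : M} (hg : ContMDiffAt IM (𝓡 d) ∞ g x₀)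
    {v : ∀ x, Fin k → TangentSpace (𝓡 d) (g x)}
    (hv : ∀ i, ContMDiffAt IM (𝓡 d).tangent ∞
      (fun x => (⟨g x, v x i⟩ : TangentBundle (𝓡 d) N)) x₀) :
    ContMDiffAt IM 𝓘(ℝ, ℝ) ∞ (fun x => α (g x) (v x)) x₀ := by
  let e := trivializationAt (EuclideanSpace ℝ (Fin d)) (TangentSpace (𝓡 d)) (g x₀)
  have form_smooth : ContMDiffAt IM 𝓘(ℝ, EuclideanSpace ℝ (Fin d) [⋀^Fin k]→L[ℝ] ℝ) ∞
      (fun x => chartExpr α (g x₀) (extChartAt (𝓡 d) (g x₀) (g x))) x₀ :=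
    ((hα (g x₀)).contDiffAt (extChartAt_target_mem_nhds (g x₀))).contMDiffAt.comp x₀
      (contMDiffAt_extChartAt.comp x₀ hg)
  refine (contMDiffAt_continuousAlternatingMap_apply form_smooth
    fun i => (contMDiffAt_totalSpace.1 (hv i)).2).congr_of_eventuallyEq ?_
  filter_upwards [hg.continuousAt.eventually_mem <|
    chart_source_mem_nhds (EuclideanSpace ℝ (Fin d)) (g x₀)] with x hx
  rw [← chartExpr_apply α hx]
  refine congrArg _ (funext fun i => ?_)
  exact congrFun (e.coe_linearMapAt_of_mem hx) (v x i)

end Forms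

end Smooth

section System

variable {m n : ℕ} {M F : Type*}
  [TopologicalSpace M] [ChartedSpace (EuclideanSpace ℝ (Fin m)) M]
  [TopologicalSpace F] [ChartedSpace (EuclideanSpace ℝ (Fin (m + n))) F]

theorem FieldSystem.toAlternatingMap_η_ne_zero (S : FieldSystem m n M F) (x : M) :
    (S.η x).toAlternatingMap ≠ 0 := fun h =>
  S.η_ne_zero x (ContinuousAlternatingMap.toAlternatingMap_injective h)

variable [IsManifold (𝓡 (m + n)) ∞ F] {S : FieldSystem m n M F}

theorem flatAt_eq_targetAt_iff (hS : S.VanishesOnThreeVertical) (nabla : Connection S) (y : F)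
    (C : Submodule ℝ (TangentSpace (𝓡 (m + n)) y)) (h : TangentSpace (𝓡 m) (S.κ y) →ₗ[ℝ] C) :
    S.flatAt nabla y C h = S.targetAt nabla y ↔ S.SolvesFieldEquations y C h :=
  flat_eq_target_iff (nabla.isSection y) (S.toAlternatingMap_η_ne_zero (S.κ y)) 
    (fun v i j k => hS y v i j k) h

theorem exists_flatAt_eq_targetAt_iff (nabla : Connection S) (C : Set F) (y : F) :
    (∃ h, S.flatAt nabla y (tangentTo C y) h = S.targetAt nabla y) ↔
      ∀ p ∈ S.tangentOrth nabla C y,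
        pairing (S.dκ y) (nabla.lift y) p (S.targetAt nabla y) = 0 :=
  have : FiniteDimensional ℝ (TangentSpace (𝓡 m) (S.κ y)) :=
    inferInstanceAs (FiniteDimensional ℝ (EuclideanSpace ℝ (Fin m)))
  have : FiniteDimensional ℝ (TangentSpace (𝓡 (m + n)) y) :=
    inferInstanceAs (FiniteDimensional ℝ (EuclideanSpace ℝ (Fin (m + n))))
  exists_flat_eq_iff (nabla.isSection y) _

variable [IsManifold (𝓡 m) ∞ M]

theorem Connection.contMDiffAt_lift (nabla : Connection S)
    {X : ∀ y, TangentSpace (𝓡 m) (S.κ y)} {y₀ : F}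
    (hX : ContMDiffAt (𝓡 (m + n)) (𝓡 m).tangent ∞
      (fun y => (⟨S.κ y, X y⟩ : TangentBundle (𝓡 m) M)) y₀) :
    ContMDiffAt (𝓡 (m + n)) (𝓡 (m + n)).tangent ∞
      (fun y => (⟨y, nabla.lift y (X y)⟩ : TangentBundle (𝓡 (m + n)) F)) y₀ := by
  have dκ_smooth := S.κ_smooth.contMDiffAt.mfderiv_const (x₀ := y₀) (m := ∞) le_rfl
  obtain ⟨W, W_smooth, hW⟩ := exists_contMDiffAt_lift_of_surjective contMDiffAt_id dκ_smooth
    (S.κ_submersion y₀) hX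
  refine (nabla.smooth.contMDiffAt.comp y₀ W_smooth).congr_of_eventuallyEq ?_
  filter_upwards [hW] with y hy
  exact congrArg (fun x => (⟨y, nabla.lift y x⟩ : TangentBundle (𝓡 (m + n)) F)) hy.symm

theorem contMDiffAt_trace_comp_lift (nabla : Connection S) {U : Set F} (hU : IsOpen U)
    {s : ∀ y : F, DualPairSpace (S.dκ y)} (hs : S.IsSmoothDualSection U s) {y₀ : F}
    (hy₀ : y₀ ∈ U) :
    ContMDiffAt (𝓡 (m + n)) 𝓘(ℝ, ℝ) ∞
      (fun y => LinearMap.trace ℝ (TangentSpace (𝓡 m) (S.κ y))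
        (((s y).1 : TangentSpace (𝓡 (m + n)) y →ₗ[ℝ] TangentSpace (𝓡 m) (S.κ y)) ∘ₗ
          nabla.lift y)) y₀ := by
  refine contMDiffAt_trace_of_forall_contMDiffAt (IB₁ := 𝓡 m)
    (F₁ := EuclideanSpace ℝ (Fin m)) (E₁ := TangentSpace (𝓡 m)) S.κ_smooth.contMDiffAt
    fun X hX => ?_
  have isOpen_preimage : IsOpen {v : TangentBundle (𝓡 (m + n)) F | v.proj ∈ U} :=
    hU.preimage (FiberBundle.continuous_proj _ _)
  exact (hs.1.contMDiffAt (isOpen_preimage.mem_nhds hy₀)).comp y₀ (nabla.contMDiffAt_lift hX)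

theorem contMDiffAt_gammaForm (nabla : Connection S)
    {Z : ∀ y : F, TangentSpace (𝓡 (m + n)) y} {y₀ : F}
    (hZ : ContMDiffAt (𝓡 (m + n)) (𝓡 (m + n)).tangent ∞
      (fun y => (⟨y, Z y⟩ : TangentBundle (𝓡 (m + n)) F)) y₀) :
    ContMDiffAt (𝓡 (m + n)) 𝓘(ℝ, ℝ) ∞
      (fun y => gammaForm (frame m (S.κ y)) (S.η (S.κ y)).toAlternatingMap
        (S.Ω y).toAlternatingMap (nabla.lift y) (Z y)) y₀ := by
  let e := trivializationAt (EuclideanSpace ℝ (Fin m)) (TangentSpace (𝓡 m) (M := M)) (S.κ y₀)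
  let b := (EuclideanSpace.basisFun (Fin m) ℝ).toBasis
  have hκ₀ : S.κ y₀ ∈ e.baseSet := FiberBundle.mem_baseSet_trivializationAt' (S.κ y₀)
  have frame_smooth (i : Fin m) : ContMDiffAt (𝓡 (m + n)) (𝓡 m).tangent ∞
      (fun y => (⟨S.κ y, e.localFrame b i (S.κ y)⟩ : TangentBundle (𝓡 m) M)) y₀ :=
    (contMDiffAt_localFrame_of_mem (I := 𝓡 m) ∞ e b i hκ₀).comp y₀ S.κ_smooth.contMDiffAt
  have volume_smooth : ContMDiffAt (𝓡 (m + n)) 𝓘(ℝ, ℝ) ∞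
      (fun y => S.η (S.κ y) fun i => e.localFrame b i (S.κ y)) y₀ :=
    contMDiffAt_formField_apply S.η_smooth S.κ_smooth.contMDiffAt frame_smooth
  have volume_ne_zero : (S.η (S.κ y₀) fun i => e.localFrame b i (S.κ y₀)) ≠ 0 := by
    simp only [e.localFrame_apply_of_mem_baseSet b hκ₀]
    exact ((S.η (S.κ y₀)).toAlternatingMap.map_basis_ne_zero_iff (e.basisAt b hκ₀)).2
      (S.toAlternatingMap_η_ne_zero (S.κ y₀))
  have contraction_smooth : ContMDiffAt (𝓡 (m + n)) 𝓘(ℝ, ℝ) ∞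
      (fun y => contract (S.Ω y).toAlternatingMap
        (fun i => nabla.lift y (e.localFrame b i (S.κ y))) (Z y)) y₀ := by
    refine contMDiffAt_formField_apply (g := fun y => y) S.Ω_smooth contMDiffAt_id
      (Fin.lastCases ?_ fun i => ?_)
    · simpa only [Fin.snoc_last] using hZ
    · simpa only [Fin.snoc_castSucc] using nabla.contMDiffAt_lift (frame_smooth i)
  refine ((volume_smooth.inv₀ volume_ne_zero).mul contraction_smooth).congr_of_eventuallyEq ?_
  filter_upwards [eventually_mem_baseSet_trivializationAt (F := EuclideanSpace ℝ (Fin m))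
    (TangentSpace (𝓡 m)) S.κ_smooth.continuous.continuousAt] with y hy
  have frame_eq : (fun i => e.localFrame b i (S.κ y)) = e.basisAt b hy :=
    funext fun i => e.localFrame_apply_of_mem_baseSet b hy
  rw [gammaForm_eq_of_basis _ (e.basisAt b hy)]
  exact congrArg (fun v => (S.η (S.κ y) v)⁻¹ *
    contract (S.Ω y).toAlternatingMap (fun i => nabla.lift y (v i)) (Z y)) frame_eq.symm

theorem contMDiffOn_constraint (nabla : Connection S) {U : Set F} (hU : IsOpen U)
    {s : ∀ y : F, DualPairSpace (S.dκ y)} (hs : S.IsSmoothDualSection U s) :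
    ContMDiffOn (𝓡 (m + n)) 𝓘(ℝ, ℝ) ∞ (S.constraint nabla s) U := fun y hy => by
  have constraint_eq : S.constraint nabla s = fun y =>
      LinearMap.trace ℝ (TangentSpace (𝓡 m) (S.κ y))
        (((s y).1 : TangentSpace (𝓡 (m + n)) y →ₗ[ℝ] TangentSpace (𝓡 m) (S.κ y)) ∘ₗ
          nabla.lift y) -
      gammaForm (frame m (S.κ y)) (S.η (S.κ y)).toAlternatingMap
        (S.Ω y).toAlternatingMap (nabla.lift y) (s y).2 :=
    funext fun y => (sub_eq_add_neg _ _).symm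
  rw [constraint_eq]
  exact ((contMDiffAt_trace_comp_lift nabla hU hs hy).sub
    (contMDiffAt_gammaForm nabla (hs.2.contMDiffAt (hU.mem_nhds hy)))).contMDiffWithinAt

theorem mainTheorem3_general (S : FieldSystem m n M F) (hS : S.VanishesOnThreeVertical)
    (nabla : Connection S) (i : ℕ) :
    (S.constraintSet nabla (i + 1) = {y | y ∈ S.constraintSet nabla i ∧
      ∃ h, S.SolvesFieldEquations y (tangentTo (S.constraintSet nabla i) y) h}) ∧
    (S.constraintSet nabla (i + 1) = {y | y ∈ S.constraintSet nabla i ∧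
      ∀ p ∈ S.tangentOrth nabla (S.constraintSet nabla i) y,
        pairing (S.dκ y) (nabla.lift y) p (S.targetAt nabla y) = 0}) ∧
    ∀ (ι : Type*) (U : Set F), IsOpen U →
      ∀ s : ι → ∀ y : F, DualPairSpace (S.dκ y),
        (∀ j, S.IsSmoothDualSection U (s j)) →
        (∀ y ∈ S.constraintSet nabla i ∩ U,
          Submodule.span ℝ (Set.range fun j => s j y) =
            S.tangentOrth nabla (S.constraintSet nabla i) y) →
        (∀ j, ContMDiffOn (𝓡 (m + n)) 𝓘(ℝ, ℝ) ∞ (S.constraint nabla (s j)) U) ∧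
        S.constraintSet nabla (i + 1) ∩ U =
          {y | y ∈ S.constraintSet nabla i ∩ U ∧ ∀ j, S.constraint nabla (s j) y = 0} := by
  have intrinsic : S.constraintSet nabla (i + 1) = {y | y ∈ S.constraintSet nabla i ∧
      ∀ p ∈ S.tangentOrth nabla (S.constraintSet nabla i) y,
        pairing (S.dκ y) (nabla.lift y) p (S.targetAt nabla y) = 0} :=
    Set.ext fun y => and_congr_right fun _ => exists_flatAt_eq_targetAt_iff nabla _ y
  refine ⟨Set.ext fun y => and_congr_right fun _ => exists_congr fun h =>
    flatAt_eq_targetAt_iff hS nabla y _ h, intrinsic, fun ι U hU s hs hspan =>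
    ⟨fun j => contMDiffOn_constraint nabla hU (hs j), ?_⟩⟩
  rw [intrinsic]
  ext y
  refine and_right_comm.trans (and_congr_right fun hy => ?_)
  rw [← hspan y hy]
  exact forall_mem_span_range_eq_zero_iff
    ((pairing (S.dκ y) (nabla.lift y)).flip (S.targetAt nabla y)) _

end System

end PreMultisymplectic

open PreMultisymplectic in
theorem mainTheorem3 {m n : ℕ} (hm : 1 < m) {M F : Type*}
    [TopologicalSpace M] [T2Space M] [ParacompactSpace M]
    [ChartedSpace (EuclideanSpace ℝ (Fin m)) M] [IsManifold (𝓡 m) ∞ M]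
    [TopologicalSpace F] [T2Space F] [ParacompactSpace F]
    [ChartedSpace (EuclideanSpace ℝ (Fin (m + n))) F] [IsManifold (𝓡 (m + n)) ∞ F]
    (S : FieldSystem m n M F) (hS : S.VanishesOnThreeVertical) (nabla : Connection S)
    (hC : ∀ i, IsRegularSubmanifold (d := m + n) (S.constraintSet nabla i)) (i : ℕ) :
    -- `C_{i+1}` is the set of points of `C_i` with a solution of the field equations in `T C_i`
    (S.constraintSet nabla (i + 1) = {y | y ∈ S.constraintSet nabla i ∧
      ∃ h, S.SolvesFieldEquations y (tangentTo (S.constraintSet nabla i) y) h}) ∧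
    -- intrinsic description of `C_{i+1}`
    (S.constraintSet nabla (i + 1) = {y | y ∈ S.constraintSet nabla i ∧
      ∀ p ∈ S.tangentOrth nabla (S.constraintSet nabla i) y,
        pairing (S.dκ y) (nabla.lift y) p (S.targetAt nabla y) = 0}) ∧
    -- local description by the constraint functions
    (∀ r : ℕ,
      (∀ y ∈ S.constraintSet nabla i,
        Module.finrank ℝ (S.tangentOrth nabla (S.constraintSet nabla i) y) = r) →
      ∀ (U : Set F), IsOpen U →
      ∀ s : Fin r → ∀ y : F, DualPairSpace (S.dκ y),
        (∀ j, S.IsSmoothDualSection U (s j)) →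
        (∀ y ∈ S.constraintSet nabla i ∩ U,
          Submodule.span ℝ (Set.range fun j => s j y) =
            S.tangentOrth nabla (S.constraintSet nabla i) y) →
        (∀ j, ContMDiffOn (𝓡 (m + n)) 𝓘(ℝ, ℝ) ∞ (S.constraint nabla (s j)) U) ∧
        S.constraintSet nabla (i + 1) ∩ U =
          {y | y ∈ S.constraintSet nabla i ∩ U ∧ ∀ j, S.constraint nabla (s j) y = 0}) := by
  obtain ⟨solutions, intrinsic, constraints⟩ := mainTheorem3_general S hS nabla i
  exact ⟨solutions, intrinsic, fun r _ => constraints (Fin r)⟩
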